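/- Let $\delta_1,c_1,c_2>0$. There is a constant $C=C(\delta_1,c_1,c_2)<\infty$ such that the following holds for all $\epsilon>0$ and $L>0$. Let $\mu$ be a probability measure on $\mathbb{R}$ with density $p$ with respect to Lebesgue measure, and let $Q$ be a proposal kernel on $\mathbb{R}$ with density $q(x,y)=q(|x-y|)$, where $x\mapsto q(|x|)$ is a unimodal probability density with $$q(|x|)\ \ge\ \delta_1\mathbf 1_{|x|\le\epsilon},\qquad q(|x|)\ \le\ c_1e^{-c_2|x|/\epsilon}\qquad(x\in\mathbb{R}).$$ Let $P$ be the Metropolis–Hastings kernel with target $\mu$ and proposal $Q$, i.e. the kernel that moves from $x$ to a proposed $y\sim Q(x,\cdot)$ with probability $\alpha(x,y)=1\wedge\frac{p(y)q(y,x)}{p(x)q(x,y)}$ and stays at $x$ otherwise, and assume that there are $\gamma\in(0,1)$, $0\le K<\infty$ and $V:\mathbb{R}\to[0,\infty)$ with $(PV)(x)\le\gamma V(x)+K$ for all $x$. Let $\Theta\subset\mathbb{R}$ be convex with $\mu(\Theta)>0$, such that $0<p<\infty$ on $\Theta$, $p$ is unimodal on $\Theta$ with mode $m\in\Theta$ (weakly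 increasing on $\Theta\cap(-\infty,m]$ and weakly decreasing on $\Theta\cap[m,\infty)$), and $\Theta\subseteq B_L(m)=(m-L,m+L)$. Let $\mu_\Theta(A)=\mu(\Theta\cap A)/\mu(\Theta)$, with density $p_\Theta=p\,\mathbf 1_\Theta/\mu(\Theta)$, and let $P_\Theta$ be the Metropolis–Hastings kernel with target $\mu_\Theta$ and proposal $Q$. Write $\|\mu-\nu\|_{\mathrm{TV}}=\sup_A|\mu(A)-\nu(A)|$ and, for $A\subset\Theta$, $$\tau(P_\Theta)=\min\Big\{t\in\mathbb{N}:\sup_{x\in\Theta}\|\delta_xP_\Theta^t-\mu_\Theta\|_{\mathrm{TV}}<\tfrac14\Big\},\qquad \tau_A(P_\Theta)=\min\Big\{t\in\mathbb{N}:\sup_{x\in A}\|\delta_xP_\Theta^t-\mu_\Theta\|_{\mathrm{TV}}\le\tfrac18\Big\},$$ with value $\infty$ if there is no such $t$. Then $$\tau(P_\Theta)\ \le\ \tau_{[m-\epsilon,m+\epsilon]\cap\Theta}(P_\Theta)+C\,\frac{L^2}{\epsilon^2}.$$ -/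

import Mathlib

open MeasureTheory ProbabilityTheory Set
open scoped ENNReal NNReal

noncomputable section

/-- `f` is unimodal on `s` with mode `m`: it is (weakly) increasing on `s` to the left of `m` and
(weakly) decreasing on `s` to the right of `m`. -/
def UnimodalOn (f : ℝ → ℝ) (s : Set ℝ) (m : ℝ) : Prop :=
  m ∈ s ∧ MonotoneOn f (s ∩ Iic m) ∧ AntitoneOn f (s ∩ Ici m)

/-- The measure on `ℝ` with density `p` with respect to Lebesgue measure. -/
def densityMeasure (p : ℝ → ℝ) : Measure ℝ :=
  volume.withDensity fun x => ENNReal.ofReal (p x)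

/-- The density `p_Θ(x) = p(x) 1_{x ∈ Θ} / μ(Θ)` of the target conditioned on `Θ`. -/
def restrictDensity (p : ℝ → ℝ) (Θ : Set ℝ) : ℝ → ℝ :=
  fun x => Θ.indicator p x / (densityMeasure p).real Θ

/-- The isotropic proposal density `q(x, y) = q(‖x - y‖)`. -/
def isotropic (q : ℝ → ℝ) (x y : ℝ) : ℝ := q ‖x - y‖

/-- The Metropolis-Hastings acceptance probability `1 ∧ p(y) q(y,x) / (p(x) q(x,y))`
for target density `p` and proposal density `q`. -/
def acceptProb (p : ℝ → ℝ) (q : ℝ → ℝ → ℝ) (x y : ℝ) : ℝ :=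
  min 1 (p y * q y x / (p x * q x y))

/-- The density `α(x,y) q(x,y)` of the accepted moves. -/
def moveDensity (p : ℝ → ℝ) (q : ℝ → ℝ → ℝ) (x y : ℝ) : ℝ≥0∞ :=
  ENNReal.ofReal (acceptProb p q x y * q x y)

/-- The probability of rejecting a move proposed at `x`. -/
def rejectProb (p : ℝ → ℝ) (q : ℝ → ℝ → ℝ) (x : ℝ) : ℝ≥0∞ :=
  1 - ∫⁻ y, moveDensity p q x y

/-- The Metropolis-Hastings kernel with target density `p` and proposal density `q`:
`P(x, dy) = α(x,y) q(x,y) dy + r(x) δ_x(dy)`, with `r(x)` the rejection probability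
(see `mhKernel_apply`). -/
def mhKernel (p : ℝ → ℝ) (q : ℝ → ℝ → ℝ) : Kernel ℝ ℝ :=
  (Kernel.const ℝ (volume : Measure ℝ)).withDensity (moveDensity p q)
    + (Kernel.id : Kernel ℝ ℝ).withDensity (fun x _ => rejectProb p q x)

/-- Total variation distance, `sup_A |μ(A) - ν(A)|` over measurable sets `A`. -/
def tvDist (μ ν : Measure ℝ) : ℝ≥0∞ :=
  ⨆ (A : Set ℝ) (_ : MeasurableSet A), ENNReal.ofReal |μ.real A - ν.real A|

/-- `sup_{x ∈ A} ‖δ_x P^t - μ‖_TV`. -/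
def worstTV (P : Kernel ℝ ℝ) (μ : Measure ℝ) (A : Set ℝ) (t : ℕ) : ℝ≥0∞ :=
  ⨆ x ∈ A, tvDist ((P ^ t) x) μ

/-- Mixing time on `Θ`: the least `t` with `sup_{x ∈ Θ} ‖δ_x P^t - μ‖_TV < 1/4`,
and `⊤` if there is none. -/
def mixingTime (P : Kernel ℝ ℝ) (μ : Measure ℝ) (Θ : Set ℝ) : ℕ∞ :=
  sInf ((fun t : ℕ => (t : ℕ∞)) '' {t | worstTV P μ Θ t < 1 / 4})

/-- `A`-restricted mixing time: the least `t` with `sup_{x ∈ A} ‖δ_x P^t - μ‖_TV ≤ 1/8`,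
and `⊤` if there is none. -/
def restrictedMixingTime (P : Kernel ℝ ℝ) (μ : Measure ℝ) (A : Set ℝ) : ℕ∞ :=
  sInf ((fun t : ℕ => (t : ℕ∞)) '' {t | worstTV P μ A t ≤ 1 / 8})

/-- The standing assumption, at scale `ε` and with constants `δ₁, c₁, c₂`, on the
Metropolis-Hastings kernel with target density `p` and isotropic proposal `q(‖x - y‖)`. -/
structure MHAssumption (ε δ₁ c₁ c₂ : ℝ) (p q : ℝ → ℝ) : Prop where
  measurable_target : Measurable p
  target_nonneg : ∀ x, 0 ≤ p x
  target_prob : ∫⁻ x, ENNReal.ofReal (p x) = 1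
  measurable_proposal : Measurable q
  proposal_nonneg : ∀ x : ℝ, 0 ≤ q ‖x‖
  proposal_prob : ∫⁻ x : ℝ, ENNReal.ofReal (q ‖x‖) = 1
  proposal_unimodal : ∃ a : ℝ, UnimodalOn (fun x => q ‖x‖) univ a
  proposal_lower : ∀ x : ℝ, ‖x‖ ≤ ε → δ₁ ≤ q ‖x‖
  proposal_upper : ∀ x : ℝ, q ‖x‖ ≤ c₁ * Real.exp (-(c₂ * ‖x‖ / ε))
  lyapunov : ∃ (γ K : ℝ≥0) (V : ℝ → ℝ≥0), 0 < γ ∧ γ < 1 ∧ Measurable V ∧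
    ∀ x, ∫⁻ y, V y ∂(mhKernel p (isotropic q) x) ≤ γ * V x + K

theorem measurable_moveDensity {p : ℝ → ℝ} {q : ℝ → ℝ → ℝ} (hp : Measurable p)
    (hq : Measurable (Function.uncurry q)) :
    Measurable (Function.uncurry (moveDensity p q)) := by
  have hq' : Measurable fun z : ℝ × ℝ => q z.1 z.2 := hq
  have hqs : Measurable fun z : ℝ × ℝ => q z.2 z.1 := hq.comp measurable_swap
  unfold Function.uncurry moveDensity acceptProb
  fun_prop

theorem measurable_isotropic {q : ℝ → ℝ} (hq : Measurable q) :
    Measurable (Function.uncurry (isotropic q)) := by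
  unfold Function.uncurry isotropic
  fun_prop

/-- The defining formula of the Metropolis-Hastings kernel. -/
theorem mhKernel_apply {p : ℝ → ℝ} {q : ℝ → ℝ → ℝ} (hp : Measurable p)
    (hq : Measurable (Function.uncurry q)) (x : ℝ) :
    mhKernel p q x = volume.withDensity (moveDensity p q x)
      + rejectProb p q x • Measure.dirac x := by
  have hm := measurable_moveDensity hp hq
  have hr : Measurable (rejectProb p q) := by
    unfold rejectProb
    exact measurable_const.sub hm.lintegral_prod_right'
  have hr' : Measurable (Function.uncurry fun (x : ℝ) (_ : ℝ) => rejectProb p q x) :=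
    hr.comp measurable_fst
  unfold mhKernel
  rw [_root_.add_apply, Kernel.withDensity_apply _ hm, Kernel.withDensity_apply _ hr',
    Kernel.const_apply, Kernel.id_apply, withDensity_const]

end

noncomputable section

/-! Write `A` for the interval of radius `ε` about the mode. Once the chain has entered `A`, the
restricted mixing time takes over, and invariance of the target keeps the error from growing
afterwards. It remains to show that from any point of `Θ` the chain hits `A` within a constant times
`L ^ 2 / ε ^ 2` steps, except with probability at most 1/16. Dynkin's bound and monotonicity of the
avoidance probability reduce this to a drift inequality off `A` (`worstTV_add_le_of_drift`).

The drift function is `h (min |x - m| L)` with `h` increasing and concave (`driftProfile`). A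
proposal landing between the current point and the mode is always accepted, by unimodality. All
other proposals are accepted with some unknown probability, so they are charged the largest increase
they could cause, which is linear in the jump length. By symmetry of `q` the linear terms cancel,
except that jumps over the mode are counted as losses instead of gains. That excess is at most of
order `h' r * exp (-c * r)`, by the exponential tail. The factor `exp (K * exp (-c * r))` in `h'`
makes `-h''` at least `1 + K * c * exp (-c * r) * h' r`: the second term absorbs the excess, and the
1 leaves a decrease of order `δ₁ * ε ^ 3` (`mhKernel_drift`).

Since `h` is at most of order `L ^ 2`, hitting `A` takes order `L ^ 2 / ε ^ 3` steps. Normalization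
of `q` under its exponential bound keeps `ε` above a constant, which trades the third power for the
second. -/

/-- The probability that the chain with kernel `P` started at `x` avoids `A` up to time `n`. -/
def avoidProb (P : Kernel ℝ ℝ) (A : Set ℝ) : ℕ → ℝ → ℝ≥0∞
  | 0 => Aᶜ.indicator 1
  | n + 1 => Aᶜ.indicator fun x => ∫⁻ y, avoidProb P A n y ∂P x

/-! ### Hitting times, drift conditions and total variation -/

section Avoid

variable {P : Kernel ℝ ℝ} {A Θ : Set ℝ}

theorem measurable_avoidProb (hA : MeasurableSet A) (n : ℕ) : Measurable (avoidProb P A n) := by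
  induction n with
  | zero => exact measurable_one.indicator hA.compl
  | succ n ih => exact (ih.lintegral_kernel).indicator hA.compl

theorem avoidProb_succ_le [IsMarkovKernel P] (n : ℕ) (x : ℝ) :
    avoidProb P A (n + 1) x ≤ avoidProb P A n x := by
  induction n generalizing x with
  | zero =>
    refine indicator_le_indicator' fun _ => ?_
    calc ∫⁻ y, avoidProb P A 0 y ∂P x ≤ ∫⁻ _, 1 ∂P x :=
          lintegral_mono fun y => indicator_le_self' (fun _ _ => zero_le_one) y
      _ = 1 := by simp
  | succ n ih =>
    exact indicator_le_indicator (lintegral_mono fun y => ih y)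

theorem avoidProb_antitone [IsMarkovKernel P] (x : ℝ) : Antitone fun n => avoidProb P A n x :=
  antitone_nat_of_succ_le fun n => avoidProb_succ_le n x

/-- Dynkin's bound on the expected hitting time of `A`, from a drift condition off `A`. -/
theorem mul_sum_avoidProb_le (hA : MeasurableSet A) {F : ℝ → ℝ≥0∞} {η : ℝ≥0∞}
    (hΘ : ∀ x ∈ Θ, ∀ᵐ y ∂P x, y ∈ Θ)
    (hdrift : ∀ x ∈ Θ, x ∉ A → ∫⁻ y, F y ∂P x + η ≤ F x) (t : ℕ) :
    ∀ x ∈ Θ, η * ∑ n ∈ Finset.range t, avoidProb P A n x ≤ F x := by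
  induction t with
  | zero => simp
  | succ t ih =>
    intro x hx
    by_cases hxA : x ∈ A
    · have : ∀ n, avoidProb P A n x = 0 := by
        intro n
        cases n <;> simp [avoidProb, hxA]
      simp [this]
    · refine le_trans ?_ (hdrift x hx hxA)
      rw [Finset.sum_range_succ', mul_add]
      have h0 : avoidProb P A 0 x = 1 := by simp [avoidProb, hxA]
      have hs : ∀ n, avoidProb P A (n + 1) x = ∫⁻ y, avoidProb P A n y ∂P x := by
        intro n; simp [avoidProb, hxA]
      simp only [h0, hs, mul_one]
      gcongr
      rw [← lintegral_finsetSum _ fun n _ => measurable_avoidProb hA n,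
        ← lintegral_const_mul _ (Finset.measurable_fun_sum _ fun n _ => measurable_avoidProb hA n)]
      refine lintegral_mono_ae ?_
      filter_upwards [hΘ x hx] with y hy using ih y hy

theorem mul_mul_avoidProb_le [IsMarkovKernel P] (hA : MeasurableSet A) {F : ℝ → ℝ≥0∞} {η : ℝ≥0∞}
    (hΘ : ∀ x ∈ Θ, ∀ᵐ y ∂P x, y ∈ Θ)
    (hdrift : ∀ x ∈ Θ, x ∉ A → ∫⁻ y, F y ∂P x + η ≤ F x) (t : ℕ) {x : ℝ} (hx : x ∈ Θ) :
    η * (t * avoidProb P A t x) ≤ F x := by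
  refine le_trans ?_ (mul_sum_avoidProb_le hA hΘ hdrift t x hx)
  gcongr
  calc (t : ℝ≥0∞) * avoidProb P A t x = ∑ n ∈ Finset.range t, avoidProb P A t x := by simp
    _ ≤ _ := Finset.sum_le_sum fun n hn =>
      avoidProb_antitone x (Finset.mem_range.1 hn).le

/-- The chain is within `e + P(A not hit by time n)` of `μ` after `n + s` steps if, from `A`,
it is within `e` of `μ` at all times from `s` on. -/
theorem pow_add_apply_le_avoidProb [IsMarkovKernel P] {μ : Measure ℝ}
    {e : ℝ≥0∞} {s : ℕ} {B : Set ℝ} (hB : MeasurableSet B)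
    (hΘ : ∀ x ∈ Θ, ∀ᵐ y ∂P x, y ∈ Θ)
    (hP : ∀ n, ∀ x ∈ A ∩ Θ, (P ^ (n + s)) x B ≤ μ B + e) (n : ℕ)
    (hle : ∀ x, (P ^ s) x B ≤ 1) :
    ∀ x ∈ Θ, (P ^ (n + s)) x B ≤ μ B + e + avoidProb P A n x := by
  induction n with
  | zero =>
    intro x hx
    by_cases hxA : x ∈ A
    · exact (hP 0 x ⟨hxA, hx⟩).trans le_self_add
    · simpa [avoidProb, hxA] using (hle x).trans le_add_self
  | succ n ih =>
    intro x hx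
    by_cases hxA : x ∈ A
    · exact (hP _ x ⟨hxA, hx⟩).trans le_self_add
    -- Off `A`, conditioning on the first step suffices, so no strong Markov property is needed.
    · rw [show n + 1 + s = 1 + (n + s) by ring, Kernel.pow_add_apply_eq_lintegral _ _ _ _ hB, pow_one]
      calc ∫⁻ y, (P ^ (n + s)) y B ∂P x ≤ ∫⁻ y, (μ B + e + avoidProb P A n y) ∂P x := by
            refine lintegral_mono_ae ?_
            filter_upwards [hΘ x hx] with y hy using ih y hy
        _ = _ := by
            rw [lintegral_add_left measurable_const]
            simp [avoidProb, hxA]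

instance isMarkovKernel_pow [IsMarkovKernel P] (n : ℕ) : IsMarkovKernel (P ^ n) := by
  induction n with
  | zero => rw [pow_zero]; exact inferInstanceAs (IsMarkovKernel Kernel.id)
  | succ n ih => rw [pow_succ]; exact inferInstanceAs (IsMarkovKernel ((P ^ n) ∘ₖ P))

/-- By the layer-cake formula the integral of `g` averages the measures of its superlevel sets over
heights in `(0, 1]`, an interval of length one, so the error `e` is paid only once. -/
theorem lintegral_le_lintegral_add_of_measure_le {μ ν : Measure ℝ} {e : ℝ≥0∞}
    (h : ∀ B, MeasurableSet B → ν B ≤ μ B + e) {g : ℝ → ℝ≥0∞} (hg : Measurable g)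
    (hg1 : ∀ x, g x ≤ 1) : ∫⁻ x, g x ∂ν ≤ ∫⁻ x, g x ∂μ + e := by
  have hfin : ∀ x, g x ≠ ∞ := fun x => ne_top_of_le_ne_top ENNReal.one_ne_top (hg1 x)
  have key : ∀ ρ : Measure ℝ, ∫⁻ x, g x ∂ρ = ∫⁻ t in Ioc (0 : ℝ) 1, ρ {x | t < (g x).toReal} := by
    intro ρ
    have := lintegral_eq_lintegral_meas_lt ρ (f := fun x => (g x).toReal)
      (Filter.Eventually.of_forall fun x => ENNReal.toReal_nonneg) hg.ennreal_toReal.aemeasurable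
    simp only [ENNReal.ofReal_toReal (hfin _)] at this
    rw [this]
    rw [← Ioc_union_Ioi_eq_Ioi (zero_le_one' ℝ), lintegral_union measurableSet_Ioi
      (Ioc_disjoint_Ioi le_rfl), setLIntegral_eq_zero measurableSet_Ioi, add_zero]
    intro t ht
    have : {x | t < (g x).toReal} = ∅ := by
      ext x
      simp only [mem_ofPred_eq, mem_empty_iff_false, iff_false, not_lt]
      exact (ENNReal.toReal_mono ENNReal.one_ne_top (hg1 x)).trans (by simpa using (le_of_lt ht))
    simp [this]
  rw [key, key]
  calc _ ≤ ∫⁻ t in Ioc (0 : ℝ) 1, (μ {x | t < (g x).toReal} + e) :=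
        lintegral_mono fun t => h _ (measurableSet_lt measurable_const hg.ennreal_toReal)
    _ = _ := by rw [lintegral_add_right _ measurable_const]; simp

/-- Evolving both laws by one more step integrates a `[0, 1]`-valued function against them, and `μ`
is reproduced by invariance. -/
theorem pow_add_apply_le_of_invariant [IsMarkovKernel P] {μ : Measure ℝ} (hμ : P.Invariant μ)
    {e : ℝ≥0∞} {s : ℕ} {x : ℝ} (h : ∀ B, MeasurableSet B → (P ^ s) x B ≤ μ B + e) (n : ℕ) :
    ∀ B, MeasurableSet B → (P ^ (n + s)) x B ≤ μ B + e := by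
  induction n with
  | zero => simpa using h
  | succ n ih =>
    intro B hB
    rw [show n + 1 + s = n + s + 1 by ring, Kernel.pow_add_apply_eq_lintegral _ _ _ _ hB, pow_one]
    refine (lintegral_le_lintegral_add_of_measure_le ih (P.measurable_coe hB)
      fun y => prob_le_one).trans ?_
    rw [← Measure.bind_apply hB P.aemeasurable, hμ.def]

theorem le_add_of_tvDist_le {μ ν : Measure ℝ} [IsFiniteMeasure μ] [IsFiniteMeasure ν] {e : ℝ≥0∞}
    (h : tvDist ν μ ≤ e) {B : Set ℝ} (hB : MeasurableSet B) : ν B ≤ μ B + e := by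
  have h1 : ENNReal.ofReal |ν.real B - μ.real B| ≤ e :=
    (le_iSup₂ (f := fun (A : Set ℝ) (_ : MeasurableSet A) =>
      ENNReal.ofReal |ν.real A - μ.real A|) B hB).trans h
  refine le_trans ?_ (add_le_add_right h1 _)
  rw [← ofReal_measureReal (μ := ν), ← ofReal_measureReal (μ := μ),
    ← ENNReal.ofReal_add measureReal_nonneg (abs_nonneg _)]
  exact ENNReal.ofReal_le_ofReal (by linarith [le_abs_self (ν.real B - μ.real B)])

/-- For probability measures the one-sided bound on the complement of a set is the missing bound on
the set itself. -/
theorem tvDist_le_of_le_add {μ ν : Measure ℝ} [IsProbabilityMeasure μ] [IsProbabilityMeasure ν]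
    {e : ℝ≥0∞} (h : ∀ B, MeasurableSet B → ν B ≤ μ B + e) : tvDist ν μ ≤ e := by
  refine iSup₂_le fun B hB => ?_
  by_cases he : e = ∞
  · simp [he]
  have key : ∀ B, MeasurableSet B → ν.real B ≤ μ.real B + e.toReal := by
    intro B hB
    rw [measureReal_def, measureReal_def, ← ENNReal.toReal_add (measure_ne_top _ _) he]
    exact ENNReal.toReal_mono (by simp [he]) (h B hB)
  refine ENNReal.ofReal_le_of_le_toReal (abs_sub_le_iff.2 ⟨by linarith [key B hB], ?_⟩)
  have := key _ hB.compl
  rw [probReal_compl_eq_one_sub hB, probReal_compl_eq_one_sub hB] at this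
  linarith

/-- The mixing time bound obtained from a drift condition off `A`. -/
theorem worstTV_add_le_of_drift [IsMarkovKernel P] {μ : Measure ℝ} [IsProbabilityMeasure μ]
    (hμ : P.Invariant μ) (hA : MeasurableSet A) {F : ℝ → ℝ≥0∞} {η e d : ℝ≥0∞}
    (hΘ : ∀ x ∈ Θ, ∀ᵐ y ∂P x, y ∈ Θ)
    (hdrift : ∀ x ∈ Θ, x ∉ A → ∫⁻ y, F y ∂P x + η ≤ F x) {s t : ℕ}
    (hs : worstTV P μ (A ∩ Θ) s ≤ e)
    (ht : t ≠ 0) (hη : η ≠ 0) (hη' : η ≠ ∞) (hF : ∀ x ∈ Θ, F x ≤ η * (t * d)) :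
    worstTV P μ Θ (t + s) ≤ e + d := by
  refine iSup₂_le fun x hx => tvDist_le_of_le_add fun B hB => ?_
  have h1 := pow_add_apply_le_avoidProb (P := P) (A := A) (Θ := Θ) (μ := μ) (e := e) (s := s) hB hΘ
    (fun n x hx => pow_add_apply_le_of_invariant hμ (fun B hB => le_add_of_tvDist_le
      ((le_iSup₂ (f := fun x (_ : x ∈ A ∩ Θ) => tvDist ((P ^ s) x) μ) x hx).trans hs) hB) n B hB)
    t (fun x => prob_le_one) x hx
  rw [← add_assoc]
  refine h1.trans (add_le_add_right ?_ _)
  have h2 := (mul_mul_avoidProb_le hA hΘ hdrift t hx).trans (hF x hx)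
  rw [ENNReal.mul_le_mul_iff_right hη hη',
    ENNReal.mul_le_mul_iff_right (by exact_mod_cast ht) (ENNReal.natCast_ne_top t)] at h2
  exact h2

end Avoid

/-! ### The Metropolis–Hastings kernel: reversibility, support, generator bound -/

section MetropolisHastings

variable {p : ℝ → ℝ} {q : ℝ → ℝ}

theorem acceptProb_nonneg (hp0 : ∀ x, 0 ≤ p x) (hq0 : ∀ x : ℝ, 0 ≤ q ‖x‖) (x y : ℝ) :
    0 ≤ acceptProb p (isotropic q) x y :=
  le_min zero_le_one <| div_nonneg (mul_nonneg (hp0 _) (hq0 _)) (mul_nonneg (hp0 _) (hq0 _))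

theorem moveDensity_le (hq0 : ∀ x : ℝ, 0 ≤ q ‖x‖) (x y : ℝ) :
    moveDensity p (isotropic q) x y ≤ ENNReal.ofReal (q ‖x - y‖) :=
  ENNReal.ofReal_le_ofReal (mul_le_of_le_one_left (hq0 _) (min_le_left _ _))

theorem lintegral_moveDensity_le_one (hq0 : ∀ x : ℝ, 0 ≤ q ‖x‖)
    (hq1 : ∫⁻ x : ℝ, ENNReal.ofReal (q ‖x‖) = 1) (x : ℝ) :
    ∫⁻ y, moveDensity p (isotropic q) x y ≤ 1 := by
  refine (lintegral_mono fun y => moveDensity_le hq0 x y).trans ?_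
  rw [lintegral_sub_left_eq_self (fun y : ℝ => ENNReal.ofReal (q ‖y‖)) x, hq1]

theorem isMarkovKernel_mhKernel (hp : Measurable p) (hq : Measurable q)
    (hq0 : ∀ x : ℝ, 0 ≤ q ‖x‖) (hq1 : ∫⁻ x : ℝ, ENNReal.ofReal (q ‖x‖) = 1) :
    IsMarkovKernel (mhKernel p (isotropic q)) := by
  refine ⟨fun x => ⟨?_⟩⟩
  rw [mhKernel_apply hp (measurable_isotropic hq)]
  simp only [Measure.add_apply, Measure.smul_apply, withDensity_apply _ MeasurableSet.univ,
    Measure.restrict_univ, measure_univ, smul_eq_mul, mul_one, rejectProb]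
  exact add_tsub_cancel_of_le (lintegral_moveDensity_le_one hq0 hq1 x)

theorem measurable_rejectProb (hp : Measurable p) (hq : Measurable q) :
    Measurable (rejectProb p (isotropic q)) :=
  measurable_const.sub
    (measurable_moveDensity hp (measurable_isotropic hq)).lintegral_prod_right'

theorem lintegral_mhKernel (hp : Measurable p) (hq : Measurable q) {F : ℝ → ℝ≥0∞}
    (hF : Measurable F) (x : ℝ) :
    ∫⁻ y, F y ∂mhKernel p (isotropic q) x =
      (∫⁻ y, moveDensity p (isotropic q) x y * F y) + rejectProb p (isotropic q) x * F x := by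
  have hm : Measurable (moveDensity p (isotropic q) x) :=
    (measurable_moveDensity hp (measurable_isotropic hq)).comp measurable_prodMk_left
  rw [mhKernel_apply hp (measurable_isotropic hq), lintegral_add_measure,
    lintegral_smul_measure, lintegral_dirac' _ hF, lintegral_withDensity_eq_lintegral_mul _ hm hF]
  rfl

/-- Detailed balance: both sides equal `min (p x) (p y) * q ‖x - y‖`. Zeros of `q` and of `p` are
treated apart because the acceptance ratio then divides by zero. -/
theorem ofReal_mul_moveDensity_comm (hp0 : ∀ x, 0 ≤ p x) (x y : ℝ) :
    ENNReal.ofReal (p x) * moveDensity p (isotropic q) x y =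
      ENNReal.ofReal (p y) * moveDensity p (isotropic q) y x := by
  have key : ∀ x y, p x * (acceptProb p (isotropic q) x y * isotropic q x y)
      = min (p x) (p y) * q ‖x - y‖ := by
    intro x y
    have hs : isotropic q y x = isotropic q x y := by simp [isotropic, norm_sub_rev]
    rw [acceptProb, hs]
    change _ = _ * isotropic q x y
    rcases eq_or_ne (isotropic q x y) 0 with h | h
    · simp [h]
    rw [mul_div_mul_right _ _ h, ← mul_assoc]
    congr 1
    rcases (hp0 x).eq_or_lt with h0 | h0
    · simp [← h0, hp0 y]
    · rw [mul_min_of_nonneg _ _ h0.le, mul_one, mul_div_cancel₀ _ h0.ne']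
  rw [moveDensity, moveDensity, ← ENNReal.ofReal_mul (hp0 x), ← ENNReal.ofReal_mul (hp0 y), key,
    key, min_comm, norm_sub_rev]

theorem mhKernel_isReversible (hp : Measurable p) (hp0 : ∀ x, 0 ≤ p x) (hq : Measurable q) :
    (mhKernel p (isotropic q)).IsReversible (densityMeasure p) := by
  intro A B hA hB
  have hm := measurable_moveDensity hp (measurable_isotropic hq)
  have hpe : Measurable fun x => ENNReal.ofReal (p x) := hp.ennreal_ofReal
  have hr := measurable_rejectProb hp hq
  -- The rejection part of the flow lives on the diagonal, hence depends only on `A ∩ B`; only the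
  -- accepted part needs detailed balance.
  have key : ∀ {A B : Set ℝ}, MeasurableSet A → MeasurableSet B →
      ∫⁻ x in A, mhKernel p (isotropic q) x B ∂densityMeasure p =
      (∫⁻ x in A, ∫⁻ y in B, ENNReal.ofReal (p x) * moveDensity p (isotropic q) x y)
      + ∫⁻ x in A ∩ B, ENNReal.ofReal (p x) * rejectProb p (isotropic q) x := by
    intro A B hA hB
    rw [densityMeasure, setLIntegral_withDensity_eq_setLIntegral_mul _ hpe
      (Kernel.measurable_coe _ hB) hA]
    have h1 : ∀ x, ((fun x => ENNReal.ofReal (p x)) * fun x => mhKernel p (isotropic q) x B) x =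
        (∫⁻ y in B, ENNReal.ofReal (p x) * moveDensity p (isotropic q) x y)
        + B.indicator (fun x => ENNReal.ofReal (p x) * rejectProb p (isotropic q) x) x := by
      intro x
      have hmx : Measurable (moveDensity p (isotropic q) x) := hm.comp measurable_prodMk_left
      rw [Pi.mul_apply, mhKernel_apply hp (measurable_isotropic hq), lintegral_const_mul _ hmx]
      simp only [Measure.add_apply, Measure.smul_apply, withDensity_apply _ hB, smul_eq_mul,
        Measure.dirac_apply' _ hB, mul_add]
      congr 1
      by_cases hx : x ∈ B <;> simp [hx]
    have hi : Measurable (B.indicator fun x => ENNReal.ofReal (p x) * rejectProb p (isotropic q) x) :=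
      (hpe.mul hr).indicator hB
    simp_rw [h1]
    rw [lintegral_add_right _ hi, lintegral_indicator hB,
      Measure.restrict_restrict hB, inter_comm]
  rw [key hA hB, key hB hA, inter_comm]
  congr 1
  rw [lintegral_lintegral_swap]
  · simp_rw [ofReal_mul_moveDensity_comm hp0]
  · exact ((hpe.comp measurable_fst).mul hm).aemeasurable

theorem ae_mhKernel_mem {Θ : Set ℝ} (hΘ : MeasurableSet Θ) (hp : Measurable p) (hq : Measurable q)
    (h0 : ∀ y ∉ Θ, p y = 0) {x : ℝ} (hx : x ∈ Θ) :
    ∀ᵐ y ∂mhKernel p (isotropic q) x, y ∈ Θ := by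
  change mhKernel p (isotropic q) x Θᶜ = 0
  rw [mhKernel_apply hp (measurable_isotropic hq)]
  simp only [Measure.add_apply, Measure.smul_apply, withDensity_apply _ hΘ.compl, smul_eq_mul,
    Measure.dirac_apply' _ hΘ.compl]
  rw [setLIntegral_eq_zero hΘ.compl]
  · simp [hx]
  · intro y hy
    simp [moveDensity, acceptProb, h0 y hy]

theorem densityMeasure_restrictDensity {Θ : Set ℝ} (hΘ : MeasurableSet Θ)
    (hpos : densityMeasure p Θ ≠ 0) (hfin : densityMeasure p Θ ≠ ∞) :
    densityMeasure (restrictDensity p Θ) = (densityMeasure p)[|Θ] := by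
  have hpos' : 0 < (densityMeasure p).real Θ := ENNReal.toReal_pos hpos hfin
  rw [ProbabilityTheory.cond]
  have : (fun x => ENNReal.ofReal (restrictDensity p Θ x)) =
      (densityMeasure p Θ)⁻¹ • Θ.indicator fun x => ENNReal.ofReal (p x) := by
    ext x
    by_cases hx : x ∈ Θ
    · simp only [restrictDensity, indicator_of_mem hx, Pi.smul_apply, smul_eq_mul]
      rw [ENNReal.ofReal_div_of_pos hpos', measureReal_def, ENNReal.ofReal_toReal hfin,
        ENNReal.div_eq_inv_mul]
    · simp [restrictDensity, hx]
  rw [densityMeasure, this, withDensity_smul' _ _ (ENNReal.inv_ne_top.2 hpos),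
    withDensity_indicator hΘ, ← restrict_withDensity hΘ]
  rfl

/-- A sufficient condition for a drift inequality of the Metropolis-Hastings kernel. -/
theorem lintegral_mhKernel_add_le (hp : Measurable p) (hp0 : ∀ x, 0 ≤ p x) (hq : Measurable q)
    (hq0 : ∀ x : ℝ, 0 ≤ q ‖x‖) (hq1 : ∫⁻ x : ℝ, ENNReal.ofReal (q ‖x‖) = 1)
    {f G : ℝ → ℝ} (hf : Measurable f) (hf0 : ∀ x, 0 ≤ f x) {x η : ℝ} (hη : 0 ≤ η)
    (hG : Integrable G)
    (hle : ∀ y, acceptProb p (isotropic q) x y * q ‖x - y‖ * (f y - f x) ≤ G y)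
    (hGη : ∫ y, G y ≤ -η) :
    ∫⁻ y, ENNReal.ofReal (f y) ∂mhKernel p (isotropic q) x + ENNReal.ofReal η
      ≤ ENNReal.ofReal (f x) := by
  set a : ℝ → ℝ := fun y => acceptProb p (isotropic q) x y * q ‖x - y‖ with ha
  have hm : Measurable (Function.uncurry (moveDensity p (isotropic q))) :=
    measurable_moveDensity hp (measurable_isotropic hq)
  have ha0 : ∀ y, 0 ≤ a y := fun y => mul_nonneg (acceptProb_nonneg hp0 hq0 _ _) (hq0 _)
  have hma : ∀ y, moveDensity p (isotropic q) x y = ENNReal.ofReal (a y) := fun y => rfl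
  have hmeas : Measurable a := by
    have : a = fun y => (moveDensity p (isotropic q) x y).toReal := by
      ext y; rw [hma, ENNReal.toReal_ofReal (ha0 y)]
    rw [this]
    exact (hm.comp measurable_prodMk_left).ennreal_toReal
  have hM1 := lintegral_moveDensity_le_one (p := p) hq0 hq1 x
  simp only [hma] at hM1
  have hai : Integrable a := by
    refine ⟨hmeas.aestronglyMeasurable, ?_⟩
    rw [hasFiniteIntegral_iff_ofReal (Filter.Eventually.of_forall ha0)]
    exact hM1.trans_lt ENNReal.one_lt_top
  -- As `f` may be unbounded, integrability is extracted from `hle`, which dominates `a y * f y` by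
  -- `a y * f x + |G y|`.
  have hfi : Integrable fun y => a y * f y := by
    refine Integrable.mono' ((hai.mul_const (f x)).add hG.abs)
      (hmeas.mul hf).aestronglyMeasurable (Filter.Eventually.of_forall fun y => ?_)
    rw [Real.norm_of_nonneg (mul_nonneg (ha0 y) (hf0 y))]
    have := hle y
    have h2 := le_abs_self (G y)
    change _ ≤ a y * f x + |G y|
    change a y * (f y - f x) ≤ _ at this
    linarith
  have hint : (∫ y, a y * f y) + η ≤ (∫ y, a y) * f x := by
    have h1 : ∫ y, a y * (f y - f x) ≤ ∫ y, G y := by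
      refine integral_mono ?_ hG hle
      simpa only [mul_sub] using! hfi.sub (hai.mul_const (f x))
    simp only [mul_sub] at h1
    rw [integral_sub hfi (hai.mul_const (f x)), integral_mul_const] at h1
    linarith
  have hI1 : ∫ y, a y ≤ 1 := by
    rw [integral_eq_lintegral_of_nonneg_ae (Filter.Eventually.of_forall ha0)
      hmeas.aestronglyMeasurable]
    exact ENNReal.toReal_le_of_le_ofReal zero_le_one (by simpa using hM1)
  have hr : rejectProb p (isotropic q) x = ENNReal.ofReal (1 - ∫ y, a y) := by
    rw [rejectProb, ENNReal.ofReal_sub _ (integral_nonneg ha0), ENNReal.ofReal_one,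
      ofReal_integral_eq_lintegral_ofReal hai (Filter.Eventually.of_forall ha0)]
    rfl
  rw [lintegral_mhKernel hp hq hf.ennreal_ofReal, hr, ← ENNReal.ofReal_mul (by linarith)]
  have : ∀ y, moveDensity p (isotropic q) x y * ENNReal.ofReal (f y) =
      ENNReal.ofReal (a y * f y) := fun y => by rw [hma, ENNReal.ofReal_mul (ha0 y)]
  simp_rw [this]
  have hnn : ∀ y, 0 ≤ a y * f y := fun y => mul_nonneg (ha0 y) (hf0 y)
  rw [← ofReal_integral_eq_lintegral_ofReal hfi (Filter.Eventually.of_forall hnn),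
    ← ENNReal.ofReal_add (integral_nonneg hnn) (mul_nonneg (by linarith) (hf0 x)),
    ← ENNReal.ofReal_add (add_nonneg (integral_nonneg hnn) (mul_nonneg (by linarith) (hf0 x))) hη]
  exact ENNReal.ofReal_le_ofReal (by linarith)

end MetropolisHastings

/-! ### Moments of a symmetric proposal with exponential tails -/

section ExponentialTails

variable {b : ℝ}

theorem integral_exp_neg_mul_abs (hb : 0 < b) : ∫ x : ℝ, Real.exp (-(b * |x|)) = 2 / b := by
  rw [integral_comp_abs (f := fun x => Real.exp (-(b * x)))]
  have := Real.integral_rpow_mul_exp_neg_mul_Ioi one_pos hb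
  simp only [sub_self, Real.rpow_zero, one_mul, Real.rpow_one, Real.Gamma_one, mul_one] at this
  rw [this]
  ring

theorem integral_Ioi_mul_exp_neg_mul (hb : 0 < b) :
    ∫ x in Ioi (0 : ℝ), x * Real.exp (-(b * x)) = 1 / b ^ 2 := by
  have := Real.integral_rpow_mul_exp_neg_mul_Ioi two_pos hb
  norm_num at this
  rw [this]
  simp

theorem integral_abs_mul_exp_neg_mul_abs (hb : 0 < b) :
    ∫ x : ℝ, |x| * Real.exp (-(b * |x|)) = 2 / b ^ 2 := by
  rw [integral_comp_abs (f := fun x => x * Real.exp (-(b * x))), integral_Ioi_mul_exp_neg_mul hb]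
  ring

theorem integrable_exp_neg_mul_abs (hb : 0 < b) : Integrable fun x : ℝ => Real.exp (-(b * |x|)) :=
  -- The integral of a non-integrable function is 0 by convention, so a nonzero value proves
  -- integrability.
  not_imp_comm.1 integral_undef (by rw [integral_exp_neg_mul_abs hb]; positivity)

theorem integrable_abs_mul_exp_neg_mul_abs (hb : 0 < b) :
    Integrable fun x : ℝ => |x| * Real.exp (-(b * |x|)) :=
  not_imp_comm.1 integral_undef (by rw [integral_abs_mul_exp_neg_mul_abs hb]; positivity)

variable {q : ℝ → ℝ} {a : ℝ}

theorem integrable_mul_of_exp_tail (hq : Measurable q) (hq0 : ∀ x : ℝ, 0 ≤ q ‖x‖) (hb : 0 < b)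
    (hle : ∀ x : ℝ, q ‖x‖ ≤ a * Real.exp (-(b * ‖x‖))) : Integrable fun x : ℝ => x * q ‖x‖ := by
  refine Integrable.mono' ((integrable_abs_mul_exp_neg_mul_abs hb).const_mul a)
    (by fun_prop) (Filter.Eventually.of_forall fun x => ?_)
  rw [norm_mul, Real.norm_of_nonneg (hq0 x)]
  have := mul_le_mul_of_nonneg_left (hle x) (abs_nonneg x)
  simp only [Real.norm_eq_abs] at this ⊢
  linarith

theorem integral_mul_even_eq_zero (q : ℝ → ℝ) : ∫ x : ℝ, x * q ‖x‖ = 0 := by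
  have h := integral_neg_eq_self (fun x : ℝ => x * q ‖x‖) volume
  simp only [norm_neg, neg_mul, integral_neg] at h
  linarith

/-- Half of the exponential rate is spent on `exp (-(b / 2 * r))`; the other half keeps the first
moment finite. -/
theorem setIntegral_Ioi_mul_le_of_exp_tail (hq : Measurable q) (hq0 : ∀ x : ℝ, 0 ≤ q ‖x‖)
    (hb : 0 < b) (ha : 0 ≤ a) (hle : ∀ x : ℝ, q ‖x‖ ≤ a * Real.exp (-(b * ‖x‖))) {r : ℝ}
    (hr : 0 ≤ r) :
    ∫ x in Ioi r, x * q ‖x‖ ≤ 4 * a / b ^ 2 * Real.exp (-(b / 2 * r)) := by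
  have hb2 : 0 < b / 2 := by positivity
  have hint : IntegrableOn (fun x : ℝ => x * Real.exp (-(b / 2 * x))) (Ioi 0) := by
    refine (integrable_abs_mul_exp_neg_mul_abs hb2).integrableOn.congr_fun ?_ measurableSet_Ioi
    intro x hx
    simp only [abs_of_pos (mem_Ioi.1 hx)]
  have hint' := hint.const_mul (a * Real.exp (-(b / 2 * r)))
  calc ∫ x in Ioi r, x * q ‖x‖
      ≤ ∫ x in Ioi r, a * Real.exp (-(b / 2 * r)) * (x * Real.exp (-(b / 2 * x))) := by
        refine setIntegral_mono_on (integrable_mul_of_exp_tail hq hq0 hb hle).integrableOn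
          (IntegrableOn.mono_set hint' (Ioi_subset_Ioi hr)) measurableSet_Ioi fun x hx => ?_
        have hx : r < x := hx
        have hx0 : 0 < x := hr.trans_lt hx
        have h1 := hle x
        rw [Real.norm_of_nonneg hx0.le] at h1 ⊢
        have h2 : Real.exp (-(b * x)) ≤ Real.exp (-(b / 2 * r)) * Real.exp (-(b / 2 * x)) := by
          rw [← Real.exp_add]
          gcongr
          nlinarith
        calc x * q x ≤ x * (a * (Real.exp (-(b / 2 * r)) * Real.exp (-(b / 2 * x)))) := by
              gcongr
              exact h1.trans (by gcongr)
          _ = _ := by ring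
    _ ≤ ∫ x in Ioi 0, a * Real.exp (-(b / 2 * r)) * (x * Real.exp (-(b / 2 * x))) := by
        refine setIntegral_mono_set hint' ?_ (Ioi_subset_Ioi hr).eventuallyLE
        refine (ae_restrict_iff' measurableSet_Ioi).2 (Filter.Eventually.of_forall fun x hx => ?_)
        have hx0 : 0 < x := hx
        simp only [Pi.zero_apply]
        positivity
    _ = _ := by
        rw [integral_const_mul, integral_Ioi_mul_exp_neg_mul hb2]
        field_simp
        ring

theorem le_setIntegral_sq_mul {δ ε : ℝ} (hε : 0 ≤ ε) (hlow : ∀ x : ℝ, ‖x‖ ≤ ε → δ ≤ q ‖x‖)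
    (hint : IntegrableOn (fun x : ℝ => x ^ 2 * q ‖x‖) (Icc 0 ε)) :
    δ * (ε ^ 3 / 3) ≤ ∫ x in Icc 0 ε, x ^ 2 * q ‖x‖ := by
  have h : ∫ x in Icc 0 ε, δ * x ^ 2 = δ * (ε ^ 3 / 3) := by
    rw [integral_Icc_eq_integral_Ioc, ← intervalIntegral.integral_of_le hε,
      intervalIntegral.integral_const_mul, integral_pow]
    norm_num
  rw [← h]
  refine setIntegral_mono_on ?_ hint measurableSet_Icc fun x hx => ?_
  · exact (by fun_prop : Continuous fun x : ℝ => δ * x ^ 2).integrableOn_Icc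
  · rw [mul_comm]
    exact mul_le_mul_of_nonneg_left
      (hlow x (by rw [Real.norm_of_nonneg hx.1]; exact hx.2)) (sq_nonneg x)

/-- Total mass one must fit under the exponential envelope. With `b = c₂ / ε` this bounds `ε` from
below. -/
theorem one_le_of_exp_tail (hb : 0 < b) (ha : 0 ≤ a)
    (hq1 : ∫⁻ x : ℝ, ENNReal.ofReal (q ‖x‖) = 1)
    (hle : ∀ x : ℝ, q ‖x‖ ≤ a * Real.exp (-(b * ‖x‖))) : 1 ≤ 2 * a / b := by
  rw [← ENNReal.one_le_ofReal, ← hq1]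
  have : 2 * a / b = ∫ x : ℝ, a * Real.exp (-(b * ‖x‖)) := by
    simp only [Real.norm_eq_abs]
    rw [integral_const_mul, integral_exp_neg_mul_abs hb]; ring
  have hi : Integrable fun x : ℝ => a * Real.exp (-(b * ‖x‖)) :=
    (integrable_exp_neg_mul_abs hb).const_mul a
  rw [this, ofReal_integral_eq_lintegral_ofReal hi
    (Filter.Eventually.of_forall fun x => by positivity)]
  exact lintegral_mono fun x => ENNReal.ofReal_le_ofReal (hle x)

end ExponentialTails

/-! ### The concave drift profile -/

/-- The derivative of `driftProfile`. -/
def driftSlope (L K c r : ℝ) : ℝ := (4 * L - r) * Real.exp (K * Real.exp (-(c * r)))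

/-- A concave increasing function of the distance to the mode, steep enough near the mode to
compensate for the outward drift due to rejected jumps over the mode. -/
def driftProfile (L K c r : ℝ) : ℝ := ∫ s in (0 : ℝ)..r, driftSlope L K c s

section Profile

variable {L K c : ℝ}

theorem continuous_driftSlope : Continuous (driftSlope L K c) := by
  unfold driftSlope
  fun_prop

theorem continuous_driftProfile : Continuous (driftProfile L K c) :=
  intervalIntegral.continuous_primitive
    (fun a b => continuous_driftSlope.intervalIntegrable a b) 0

theorem driftSlope_nonneg {r : ℝ} (hr : r ≤ 4 * L) : 0 ≤ driftSlope L K c r :=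
  mul_nonneg (by linarith) (Real.exp_pos _).le

theorem driftSlope_anti (hK : 0 ≤ K) (hc : 0 ≤ c) {r s : ℝ} (hrs : r ≤ s) (hs : s ≤ 4 * L) :
    driftSlope L K c s ≤ driftSlope L K c r := by
  unfold driftSlope
  have : 0 ≤ 4 * L - r := by linarith
  gcongr

theorem driftProfile_sub (r s : ℝ) :
    driftProfile L K c s - driftProfile L K c r = ∫ t in r..s, driftSlope L K c t :=
  intervalIntegral.integral_interval_sub_left (continuous_driftSlope.intervalIntegrable _ _)
    (continuous_driftSlope.intervalIntegrable _ _)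

theorem driftProfile_mono {r s : ℝ} (hrs : r ≤ s) (hs : s ≤ 4 * L) :
    driftProfile L K c r ≤ driftProfile L K c s := by
  rw [← sub_nonneg, driftProfile_sub]
  exact intervalIntegral.integral_nonneg hrs fun t ht => driftSlope_nonneg (ht.2.trans hs)

theorem driftProfile_nonneg {r : ℝ} (hr : 0 ≤ r) (hr' : r ≤ 4 * L) : 0 ≤ driftProfile L K c r := by
  simpa [driftProfile] using driftProfile_mono (K := K) (c := c) hr hr'

theorem driftProfile_sub_le (hK : 0 ≤ K) (hc : 0 ≤ c) {r s : ℝ} (hrs : r ≤ s) (hs : s ≤ 4 * L) :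
    driftProfile L K c s - driftProfile L K c r ≤ driftSlope L K c r * (s - r) := by
  rw [driftProfile_sub]
  calc ∫ t in r..s, driftSlope L K c t ≤ ∫ _ in r..s, driftSlope L K c r :=
        intervalIntegral.integral_mono_on hrs (continuous_driftSlope.intervalIntegrable _ _)
          (continuous_const.intervalIntegrable _ _)
          fun t ht => driftSlope_anti hK hc ht.1 (ht.2.trans hs)
    _ = _ := by simp [mul_comm]

theorem driftProfile_le (hK : 0 ≤ K) (hc : 0 ≤ c) {r : ℝ} (hr : 0 ≤ r) (hr' : r ≤ 4 * L) :
    driftProfile L K c r ≤ 4 * L * Real.exp K * r := by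
  simpa [driftProfile, driftSlope] using driftProfile_sub_le hK hc hr hr'

/-- A global form of the differential inequality behind the choice of slope: minus its derivative is
`exp (K * exp (-(c * r)))`, which is at least 1, plus `K * c * exp (-(c * r))` times the slope. It
follows from `1 + x ≤ exp x`, used once for each exponential. -/
theorem le_driftSlope (hK : 0 ≤ K) (hc : 0 ≤ c) {r t : ℝ} (htr : t ≤ r) (hr : r ≤ 4 * L) :
    driftSlope L K c r +
      (r - t) * (1 + K * c * Real.exp (-(c * r)) * driftSlope L K c r) ≤ driftSlope L K c t := by
  obtain ⟨s, hs, rfl⟩ : ∃ s, 0 ≤ s ∧ t = r - s := ⟨r - t, by linarith, by ring⟩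
  unfold driftSlope
  set E := Real.exp (-(c * r)) with hE
  have hE0 : 0 < E := Real.exp_pos _
  set g := Real.exp (K * E) with hg
  have hg1 : 1 ≤ g := Real.one_le_exp (by positivity)
  have h1 : E * (1 + c * s) ≤ Real.exp (-(c * (r - s))) := by
    have : Real.exp (-(c * (r - s))) = E * Real.exp (c * s) := by
      rw [hE, ← Real.exp_add]; congr 1; ring
    rw [this]
    gcongr
    linarith [Real.add_one_le_exp (c * s)]
  have h2 : g * (1 + K * E * (c * s)) ≤ Real.exp (K * Real.exp (-(c * (r - s)))) := by
    calc g * (1 + K * E * (c * s)) ≤ g * Real.exp (K * E * (c * s)) := by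
          gcongr
          linarith [Real.add_one_le_exp (K * E * (c * s))]
      _ = Real.exp (K * (E * (1 + c * s))) := by
          rw [hg, ← Real.exp_add]; congr 1; ring
      _ ≤ _ := by gcongr
  have hL : 0 ≤ 4 * L - r := by linarith
  have h3 : 0 ≤ K * E * (c * s) := by positivity
  calc _ = (4 * L - r) * (g * (1 + K * E * (c * s))) + s * 1 := by ring
    _ ≤ (4 * L - r) * (g * (1 + K * E * (c * s))) + s * (g * (1 + K * E * (c * s))) := by
        gcongr
        nlinarith
    _ = (4 * L - (r - s)) * (g * (1 + K * E * (c * s))) := by ring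
    _ ≤ _ := by
        gcongr
        linarith

theorem driftProfile_sub_inward_le (hK : 0 ≤ K) (hc : 0 ≤ c) {r u : ℝ} (hu : 0 ≤ u)
    (hr : r ≤ 4 * L) :
    driftProfile L K c (r - u) - driftProfile L K c r ≤ -(driftSlope L K c r * u) -
      u ^ 2 / 2 * (1 + K * c * Real.exp (-(c * r)) * driftSlope L K c r) := by
  set β := 1 + K * c * Real.exp (-(c * r)) * driftSlope L K c r with hβ
  have h : ∫ t in (r - u)..r, (driftSlope L K c r + (r - t) * β) ≤
      driftProfile L K c r - driftProfile L K c (r - u) := by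
    rw [driftProfile_sub]
    exact intervalIntegral.integral_mono_on (by linarith)
      ((by fun_prop : Continuous fun t => driftSlope L K c r + (r - t) * β).intervalIntegrable _ _)
      (continuous_driftSlope.intervalIntegrable _ _) fun t ht => le_driftSlope hK hc ht.2 hr
  have h2 : ∫ t in (r - u)..r, (driftSlope L K c r + (r - t) * β) =
      driftSlope L K c r * u + u ^ 2 / 2 * β := by
    rw [intervalIntegral.integral_comp_sub_left (fun t => driftSlope L K c r + t * β) r,
      intervalIntegral.integral_add (continuous_const.intervalIntegrable _ _)
        ((by fun_prop : Continuous fun t => t * β).intervalIntegrable _ _),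
      intervalIntegral.integral_mul_const, integral_id]
    simp
    ring
  linarith

/-- An outward move, or a move jumping over the mode. -/
theorem driftProfile_min_sub_le (hK : 0 ≤ K) (hc : 0 ≤ c) (hL : 0 ≤ L) {r w : ℝ}
    (hr0 : 0 ≤ r) (hr : r ≤ L) :
    driftProfile L K c (min |r - w| L) - driftProfile L K c r ≤ driftSlope L K c r * |w| := by
  have hs := driftSlope_nonneg (L := L) (K := K) (c := c) (r := r) (by linarith)
  have h4 : min |r - w| L ≤ 4 * L := (min_le_right _ _).trans (by linarith)
  rcases le_total (min |r - w| L) r with h | h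
  · have := driftProfile_mono (L := L) (K := K) (c := c) h (by linarith)
    nlinarith [abs_nonneg w]
  · refine (driftProfile_sub_le hK hc h h4).trans ?_
    gcongr
    have := min_le_left |r - w| L
    have := abs_sub r w
    rw [abs_of_nonneg hr0] at this
    linarith

end Profile

/-! ### Increments weighted by the proposal -/

/-- An upper bound for the increment of the drift profile when the chain, at distance `r` from the
mode, proposes to move by `w` towards the mode, weighted with the proposal density. -/
def driftBound (q : ℝ → ℝ) (φ β r ε w : ℝ) : ℝ :=
  -φ * (w * q ‖w‖) + 2 * φ * (Ioi r).indicator (fun w => w * q ‖w‖) w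
    - β / 2 * (Icc 0 ε).indicator (fun w => w ^ 2 * q ‖w‖) w

section DriftBound

variable {q : ℝ → ℝ} {a b δ ε r φ β : ℝ}

theorem integrableOn_sq_mul (hint : Integrable fun x : ℝ => x * q ‖x‖) :
    IntegrableOn (fun x : ℝ => x ^ 2 * q ‖x‖) (Icc 0 ε) := by
  have := hint.integrableOn.continuousOn_mul (K := Icc 0 ε) continuousOn_id isCompact_Icc
  refine this.congr_fun (fun x _ => ?_) measurableSet_Icc
  simp only [id]
  ring

theorem integrable_driftBound (hint : Integrable fun x : ℝ => x * q ‖x‖) :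
    Integrable (driftBound q φ β r ε) :=
  ((hint.const_mul (-φ)).add ((hint.indicator measurableSet_Ioi).const_mul (2 * φ))).sub
    (((integrableOn_sq_mul hint).integrable_indicator measurableSet_Icc).const_mul (β / 2))

theorem integral_driftBound (hint : Integrable fun x : ℝ => x * q ‖x‖) :
    ∫ w, driftBound q φ β r ε w = 2 * φ * (∫ w in Ioi r, w * q ‖w‖)
      - β / 2 * ∫ w in Icc 0 ε, w ^ 2 * q ‖w‖ := by
  have h1 : Integrable fun w => -φ * (w * q ‖w‖) := hint.const_mul (-φ)
  have h2 : Integrable fun w => 2 * φ * (Ioi r).indicator (fun w => w * q ‖w‖) w :=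
    (hint.indicator measurableSet_Ioi).const_mul (2 * φ)
  have h3 : Integrable fun w => β / 2 * (Icc 0 ε).indicator (fun w => w ^ 2 * q ‖w‖) w :=
    ((integrableOn_sq_mul hint).integrable_indicator measurableSet_Icc).const_mul (β / 2)
  unfold driftBound
  have h12 : Integrable fun w =>
      -φ * (w * q ‖w‖) + 2 * φ * (Ioi r).indicator (fun w => w * q ‖w‖) w := h1.add h2
  rw [integral_sub h12 h3, integral_add h1 h2, integral_const_mul, integral_const_mul,
    integral_const_mul, integral_mul_even_eq_zero, integral_indicator measurableSet_Ioi,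
    integral_indicator measurableSet_Icc]
  ring

/-- The condition `hκ` makes the part of `β` proportional to `φ` pay for the jumps over the mode:
with `E` the exponential factor, the tail costs at most `8 * a / b ^ 2 * E * φ`, while this part of
the quadratic gain is at least `κ * E * φ * δ * ε ^ 3 / 6`. The summand 1 in `β` yields the
remaining decrease. -/
theorem integral_driftBound_le (hq : Measurable q) (hq0 : ∀ x : ℝ, 0 ≤ q ‖x‖)
    (hb : 0 < b) (ha : 0 ≤ a) (hle : ∀ x : ℝ, q ‖x‖ ≤ a * Real.exp (-(b * ‖x‖)))
    (hε : 0 ≤ ε) (hlow : ∀ x : ℝ, ‖x‖ ≤ ε → δ ≤ q ‖x‖) (hr : 0 ≤ r) (hφ : 0 ≤ φ)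
    {κ : ℝ} (hκ : 48 * a / b ^ 2 ≤ κ * (δ * ε ^ 3)) (hκ0 : 0 ≤ κ)
    (hβ : β = 1 + κ * Real.exp (-(b / 2 * r)) * φ) :
    ∫ w, driftBound q φ β r ε w ≤ -(δ * ε ^ 3 / 6) := by
  have hint := integrable_mul_of_exp_tail hq hq0 hb hle
  rw [integral_driftBound hint]
  have h1 := setIntegral_Ioi_mul_le_of_exp_tail hq hq0 hb ha hle hr
  have h2 := le_setIntegral_sq_mul hε hlow (integrableOn_sq_mul hint)
  set E := Real.exp (-(b / 2 * r))
  have hE : 0 ≤ E := (Real.exp_pos _).le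
  have hβ0 : 0 ≤ β / 2 := by rw [hβ]; positivity
  have h3 := mul_le_mul_of_nonneg_left h1 (show 0 ≤ 2 * φ by positivity)
  have h4 := mul_le_mul_of_nonneg_left h2 hβ0
  have h5 := mul_le_mul_of_nonneg_left hκ (show 0 ≤ E * φ / 6 by positivity)
  have h6 : 2 * φ * (4 * a / b ^ 2 * E) = E * φ / 6 * (48 * a / b ^ 2) := by ring
  rw [hβ] at h4 ⊢
  nlinarith

theorem mul_driftProfile_sub_le_driftBound {L K c : ℝ} (hq0 : ∀ x : ℝ, 0 ≤ q ‖x‖) (hK : 0 ≤ K)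
    (hc : 0 ≤ c) (hε : 0 ≤ ε) (hr : ε < r) (hrL : r ≤ L) (hφ : φ = driftSlope L K c r)
    (hβ : β = 1 + K * c * Real.exp (-(c * r)) * φ) {α w : ℝ} (hα0 : 0 ≤ α) (hα1 : α ≤ 1)
    (hα : 0 ≤ w → w ≤ r → α = 1) :
    α * q ‖w‖ * (driftProfile L K c (min |r - w| L) - driftProfile L K c r) ≤
      driftBound q φ β r ε w := by
  have hr0 : 0 < r := hε.trans_lt hr
  have hφ0 : 0 ≤ φ := hφ ▸ driftSlope_nonneg (by linarith)
  have hβ0 : 0 ≤ β := by rw [hβ]; positivity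
  have hout := driftProfile_min_sub_le (w := w) hK hc (by linarith) hr0.le hrL
  rw [← hφ] at hout
  have hq := hq0 w
  have hup : α * q ‖w‖ * (driftProfile L K c (min |r - w| L) - driftProfile L K c r) ≤
      q ‖w‖ * (φ * |w|) := by
    refine (mul_le_mul_of_nonneg_left hout (by positivity)).trans ?_
    gcongr
    exact mul_le_of_le_one_left hq hα1
  unfold driftBound
  -- Three cases: moving outward, jumping over the mode, and landing between the current point and
  -- the mode. In the second, `ε < r < w` switches off the quadratic term.
  rcases lt_or_ge w 0 with hw | hw
  · rw [indicator_of_notMem (by simp; linarith), indicator_of_notMem (by simp [hw])]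
    rw [abs_of_neg hw] at hup
    linarith
  rcases lt_or_ge r w with hwr | hwr
  · rw [indicator_of_mem (by simpa using hwr),
      indicator_of_notMem (by simp only [mem_Icc, not_and, not_le]; intro; linarith)]
    rw [abs_of_nonneg hw] at hup
    linarith
  · have hin := driftProfile_sub_inward_le (L := L) hK hc hw (show r ≤ 4 * L by linarith)
    rw [hα hw hwr, one_mul, abs_of_nonneg (by linarith), min_eq_left (by linarith),
      indicator_of_notMem (by simpa using hwr)]
    rw [← hφ, ← hβ] at hin
    refine (mul_le_mul_of_nonneg_left hin hq).trans ?_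
    have : 0 ≤ w ^ 2 * q ‖w‖ := by positivity
    by_cases hwε : w ∈ Icc 0 ε
    · rw [indicator_of_mem hwε]; linarith
    · rw [indicator_of_notMem hwε]; nlinarith

end DriftBound

/-! ### The drift inequality towards the mode -/

section MetropolisDrift

variable {p q : ℝ → ℝ} {Θ : Set ℝ} {m : ℝ}

/-- The factor `q ‖x - y‖` is kept because the acceptance probability itself is 0, by the division
convention, where `q` vanishes. -/
theorem acceptProb_mul_eq {x y : ℝ} (hx : 0 < p x) (hxy : p x ≤ p y) :
    acceptProb p (isotropic q) x y * q ‖x - y‖ = 1 * q ‖x - y‖ := by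
  rcases eq_or_ne (q ‖x - y‖) 0 with h | h
  · simp only [h, mul_zero]
  · have : acceptProb p (isotropic q) x y = 1 := by
      rw [acceptProb, isotropic, isotropic, norm_sub_rev y x, mul_div_mul_right _ _ h]
      exact min_eq_left ((one_le_div hx).2 hxy)
    rw [this]

theorem UnimodalOn.le_of_between (h : UnimodalOn p Θ m) (hΘ : Convex ℝ Θ) {x y σ w : ℝ}
    (hσ : σ = 1 ∨ σ = -1) (hx : x ∈ Θ) (hw : w = σ * (x - y)) (hw0 : 0 ≤ w)
    (hwr : w ≤ σ * (x - m)) : y ∈ Θ ∧ p x ≤ p y := by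
  obtain ⟨hm, h1, h2⟩ := h
  rcases hσ with rfl | rfl
  · have hy : y ∈ Θ := hΘ.ordConnected.out hm hx ⟨by linarith, by linarith⟩
    exact ⟨hy, h2 ⟨hy, by simp only [mem_Ici]; linarith⟩ ⟨hx, by simp only [mem_Ici]; linarith⟩
      (by linarith)⟩
  · have hy : y ∈ Θ := hΘ.ordConnected.out hx hm ⟨by linarith, by linarith⟩
    exact ⟨hy, h1 ⟨hx, by simp only [mem_Iic]; linarith⟩ ⟨hy, by simp only [mem_Iic]; linarith⟩
      (by linarith)⟩

/-- The drift inequality towards the mode for the Metropolis-Hastings kernel. -/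
theorem mhKernel_drift {a b δ ε K L : ℝ} (hp : Measurable p) (hp0 : ∀ x, 0 ≤ p x)
    (hpos : ∀ x ∈ Θ, 0 < p x) (huni : UnimodalOn p Θ m)
    (hΘ : Convex ℝ Θ) (hΘL : Θ ⊆ Metric.ball m L)
    (hq : Measurable q) (hq0 : ∀ x : ℝ, 0 ≤ q ‖x‖)
    (hq1 : ∫⁻ x : ℝ, ENNReal.ofReal (q ‖x‖) = 1)
    (hb : 0 < b) (ha : 0 ≤ a) (hle : ∀ x : ℝ, q ‖x‖ ≤ a * Real.exp (-(b * ‖x‖)))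
    (hε : 0 ≤ ε) (hδ : 0 ≤ δ) (hlow : ∀ x : ℝ, ‖x‖ ≤ ε → δ ≤ q ‖x‖) (hK : 0 ≤ K)
    (hκ : 48 * a / b ^ 2 ≤ K * (b / 2) * (δ * ε ^ 3)) {x : ℝ} (hx : x ∈ Θ) (hxε : ε < |x - m|) :
    ∫⁻ y, ENNReal.ofReal (driftProfile L K (b / 2) (min |y - m| L)) ∂mhKernel p (isotropic q) x
      + ENNReal.ofReal (δ * ε ^ 3 / 6)
      ≤ ENNReal.ofReal (driftProfile L K (b / 2) (min |x - m| L)) := by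
  have hxL : |x - m| < L := by simpa [Real.dist_eq] using hΘL hx
  have hL : 0 < L := (abs_nonneg _).trans_lt hxL
  have hc : 0 ≤ b / 2 := by positivity
  set r := |x - m| with hr
  have hr0 : 0 ≤ r := abs_nonneg _
  -- The sign `σ` treats both sides of the mode at once: `σ * (x - y)` is the displacement towards
  -- the mode.
  obtain ⟨σ, hσ, hσr⟩ : ∃ σ : ℝ, (σ = 1 ∨ σ = -1) ∧ σ * (x - m) = r := by
    rcases abs_choice (x - m) with h | h
    · exact ⟨1, Or.inl rfl, by rw [hr, h]; ring⟩
    · exact ⟨-1, Or.inr rfl, by rw [hr, h]; ring⟩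
  have hσ2 : |σ| = 1 := by rcases hσ with rfl | rfl <;> simp
  set φ := driftSlope L K (b / 2) r with hφ
  set β := 1 + K * (b / 2) * Real.exp (-(b / 2 * r)) * φ with hβ
  have hφ0 : 0 ≤ φ := driftSlope_nonneg (by linarith)
  have hG0 : Integrable (driftBound q φ β r ε) :=
    integrable_driftBound (integrable_mul_of_exp_tail hq hq0 hb hle)
  have hcomp : Integrable (fun y => driftBound q φ β r ε (σ * (x - y))) ∧
      ∫ y, driftBound q φ β r ε (σ * (x - y)) = ∫ w, driftBound q φ β r ε w := by
    rcases hσ with rfl | rfl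
    · simp only [one_mul]
      exact ⟨hG0.comp_sub_left x, integral_sub_left_eq_self _ _ x⟩
    · simp only [neg_mul, one_mul, neg_sub]
      exact ⟨hG0.comp_sub_right x, integral_sub_right_eq_self _ x⟩
  refine lintegral_mhKernel_add_le hp hp0 hq hq0 hq1
    (f := fun y => driftProfile L K (b / 2) (min |y - m| L))
    (G := fun y => driftBound q φ β r ε (σ * (x - y)))
    (continuous_driftProfile.comp (by fun_prop)).measurable
    (fun y => driftProfile_nonneg (le_min (abs_nonneg _) hL.le)
      ((min_le_right _ _).trans (by linarith))) (by positivity) hcomp.1 (fun y => ?_) ?_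
  · have hy : |y - m| = |r - σ * (x - y)| := by
      rw [← hσr, ← mul_sub, abs_mul, hσ2, one_mul]; congr 1; ring
    have hnorm : ‖x - y‖ = ‖σ * (x - y)‖ := by
      rw [norm_mul, Real.norm_eq_abs σ, hσ2, one_mul]
    simp only [hy, ← hr, min_eq_left hxL.le]
    by_cases hbt : 0 ≤ σ * (x - y) ∧ σ * (x - y) ≤ r
    · obtain ⟨_, hxy⟩ := huni.le_of_between hΘ hσ hx rfl hbt.1 (hσr ▸ hbt.2)
      rw [acceptProb_mul_eq (hpos x hx) hxy, hnorm]
      exact mul_driftProfile_sub_le_driftBound hq0 hK hc hε hxε hxL.le hφ hβ zero_le_one le_rfl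
        fun _ _ => rfl
    · rw [hnorm]
      exact mul_driftProfile_sub_le_driftBound hq0 hK hc hε hxε hxL.le hφ hβ
        (acceptProb_nonneg hp0 hq0 _ _) (min_le_left _ _) fun h1 h2 => absurd ⟨h1, h2⟩ hbt
  · rw [hcomp.2]
    exact integral_driftBound_le hq hq0 hb ha hle hε hlow hr0 hφ0 hκ (by positivity) hβ

end MetropolisDrift

/-! ### Mixing times and the final choice of constants -/

theorem exists_natCast_eq_sInf_image {s : Set ℕ}
    (h : sInf ((fun t : ℕ => (t : ℕ∞)) '' s) ≠ ⊤) :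
    ∃ t ∈ s, sInf ((fun t : ℕ => (t : ℕ∞)) '' s) = t := by
  have hne : ((fun t : ℕ => (t : ℕ∞)) '' s).Nonempty := by
    rw [nonempty_iff_ne_empty]
    intro h0
    exact h (by rw [h0, sInf_empty])
  obtain ⟨t, ht, he⟩ := csInf_mem hne
  exact ⟨t, ht, he.symm⟩

theorem mixingTime_le_of_worstTV_lt {P : Kernel ℝ ℝ} {μ : Measure ℝ} {Θ : Set ℝ} {t : ℕ}
    (h : worstTV P μ Θ t < 1 / 4) : mixingTime P μ Θ ≤ t :=
  sInf_le ⟨t, h, rfl⟩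

theorem UnimodalOn.restrictDensity {p : ℝ → ℝ} {Θ : Set ℝ} {m : ℝ} (h : UnimodalOn p Θ m) :
    UnimodalOn (restrictDensity p Θ) Θ m := by
  refine ⟨h.1, fun x hx y hy hxy => ?_, fun x hx y hy hxy => ?_⟩
  · simp only [_root_.restrictDensity, indicator_of_mem hx.1, indicator_of_mem hy.1]
    exact div_le_div_of_nonneg_right (h.2.1 hx hy hxy) measureReal_nonneg
  · simp only [_root_.restrictDensity, indicator_of_mem hx.1, indicator_of_mem hy.1]
    exact div_le_div_of_nonneg_right (h.2.2 hx hy hxy) measureReal_nonneg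

end

theorem lemma3 (δ₁ c₁ c₂ : ℝ) (hδ₁ : 0 < δ₁) (hc₁ : 0 < c₁) (hc₂ : 0 < c₂) :
    ∃ C : ℝ, 0 < C ∧
      ∀ (ε L m : ℝ) (p q : ℝ → ℝ) (Θ : Set ℝ),
        0 < ε → 0 < L →
        MHAssumption ε δ₁ c₁ c₂ p q →
        Convex ℝ Θ → 0 < densityMeasure p Θ →
        (∀ x ∈ Θ, 0 < p x) → UnimodalOn p Θ m → Θ ⊆ Metric.ball m L →
        (mixingTime (mhKernel (restrictDensity p Θ) (isotropic q))
            (densityMeasure p)[|Θ] Θ : ℝ≥0∞) ≤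
          (restrictedMixingTime (mhKernel (restrictDensity p Θ) (isotropic q))
            (densityMeasure p)[|Θ] (Icc (m - ε) (m + ε) ∩ Θ) : ℝ≥0∞)
          + ENNReal.ofReal (C * (L ^ 2 / ε ^ 2)) := by
  -- This value gives equality in `hκ` below; the powers of `ε` cancel, so `K` does not depend on
  -- `ε`.
  set K := 96 * c₁ / (c₂ ^ 3 * δ₁) with hKdef
  have hK : 0 < K := by positivity
  -- Chosen so that `D * X` steps of drift `δ₁ * ε ^ 3 / 6`, times 1/16, match the bound `4 * L ^ 2
  -- * exp K` on the profile after one factor `ε` is removed through `c₂ ≤ 2 * c₁ * ε`.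
  set D := 768 * c₁ * Real.exp K / (δ₁ * c₂) with hD
  have hD0 : 0 < D := by positivity
  refine ⟨D + 1, by positivity, fun ε L m p q Θ hε hL hA hΘ hμΘ hpos huni hΘL => ?_⟩
  set P := mhKernel (restrictDensity p Θ) (isotropic q) with hP
  set μ := (densityMeasure p)[|Θ] with hμ
  set A := Icc (m - ε) (m + ε) with hAdef
  by_cases htop : restrictedMixingTime P μ (A ∩ Θ) = ⊤
  · simp [htop]
  obtain ⟨s, hs, hse⟩ := exists_natCast_eq_sInf_image htop
  change restrictedMixingTime P μ (A ∩ Θ) = s at hse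
  replace hs : worstTV P μ (A ∩ Θ) s ≤ 1 / 8 := hs
  rw [hse]
  have h84 : (1 / 8 : ℝ≥0∞) < 1 / 4 := by
    rw [one_div, one_div, ENNReal.inv_lt_inv]; norm_num
  rcases le_or_gt L ε with hLε | hLε
  · have hAΘ : A ∩ Θ = Θ := inter_eq_right.2 fun x hx => by
      have := hΘL hx
      rw [Real.ball_eq_Ioo] at this
      exact ⟨by linarith [this.1], by linarith [this.2]⟩
    rw [hAΘ] at hs
    have := mixingTime_le_of_worstTV_lt (hs.trans_lt h84)
    refine le_trans ?_ le_self_add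
    exact_mod_cast this
  have hΘm : MeasurableSet Θ := hΘ.ordConnected.measurableSet
  have hpm := hA.measurable_target
  have hqm := hA.measurable_proposal
  have hq0 := hA.proposal_nonneg
  have hq1 := hA.proposal_prob
  have : IsProbabilityMeasure (densityMeasure p) :=
    ⟨by rw [densityMeasure, withDensity_apply _ MeasurableSet.univ, Measure.restrict_univ,
      hA.target_prob]⟩
  have hΘr : 0 < (densityMeasure p).real Θ := ENNReal.toReal_pos hμΘ.ne' (measure_ne_top _ _)
  have : IsProbabilityMeasure μ := cond_isProbabilityMeasure hμΘ.ne'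
  have hrm : Measurable (restrictDensity p Θ) := (hpm.indicator hΘm).div_const _
  have hr0 : ∀ x, 0 ≤ restrictDensity p Θ x := fun x =>
    div_nonneg (indicator_nonneg (fun x _ => hA.target_nonneg x) x) hΘr.le
  have hrpos : ∀ x ∈ Θ, 0 < restrictDensity p Θ x := fun x hx => by
    simpa [restrictDensity, hx] using div_pos (hpos x hx) hΘr
  have : IsMarkovKernel P := isMarkovKernel_mhKernel hrm hqm hq0 hq1
  have hinv : P.Invariant μ := by
    rw [hμ, ← densityMeasure_restrictDensity hΘm hμΘ.ne' (measure_ne_top _ _)]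
    exact (mhKernel_isReversible hrm hr0 hqm).invariant
  have hsupp : ∀ x ∈ Θ, ∀ᵐ y ∂P x, y ∈ Θ := fun x hx =>
    ae_mhKernel_mem hΘm hrm hqm (fun y hy => by simp [restrictDensity, hy]) hx
  have htail : ∀ x : ℝ, q ‖x‖ ≤ c₁ * Real.exp (-(c₂ / ε * ‖x‖)) := fun x => by
    rw [div_mul_eq_mul_div]; exact hA.proposal_upper x
  have hb : 0 < c₂ / ε := by positivity
  have hεlow : c₂ ≤ 2 * c₁ * ε := by
    have := one_le_of_exp_tail hb hc₁.le hq1 htail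
    rw [le_div_iff₀ hb, one_mul, div_le_iff₀ hε] at this
    exact this
  have hκ : 48 * c₁ / (c₂ / ε) ^ 2 ≤ K * (c₂ / ε / 2) * (δ₁ * ε ^ 3) := by
    rw [hKdef]
    apply le_of_eq
    field_simp
    ring
  have hdrift : ∀ x ∈ Θ, x ∉ A →
      ∫⁻ y, ENNReal.ofReal (driftProfile L K (c₂ / ε / 2) (min |y - m| L)) ∂P x
      + ENNReal.ofReal (δ₁ * ε ^ 3 / 6)
      ≤ ENNReal.ofReal (driftProfile L K (c₂ / ε / 2) (min |x - m| L)) := by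
    intro x hx hxA
    refine mhKernel_drift hrm hr0 hrpos huni.restrictDensity hΘ hΘL hqm hq0 hq1 hb hc₁.le htail
      hε.le hδ₁.le hA.proposal_lower hK.le hκ hx ?_
    by_contra hcon
    rw [not_lt, abs_le] at hcon
    exact hxA ⟨by linarith [hcon.1], by linarith [hcon.2]⟩
  set X := L ^ 2 / ε ^ 2 with hX
  have hX1 : 1 ≤ X := by
    rw [hX, ← div_pow]
    exact one_le_pow₀ ((one_le_div hε).2 hLε.le)
  -- Rounding up costs at most one step, absorbed by the extra 1 in the constant since `1 ≤ X`.
  obtain ⟨t, ht1, ht2⟩ : ∃ t : ℕ, D * X ≤ t ∧ (t : ℝ) ≤ (D + 1) * X :=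
    ⟨⌈D * X⌉₊, Nat.le_ceil _, (Nat.ceil_lt_add_one (by positivity)).le.trans (by linarith)⟩
  have ht0 : (0 : ℝ) < t := lt_of_lt_of_le (by positivity) ht1
  -- An avoidance probability of 1/16 leaves room below the strict threshold: 1/8 + 1/16 < 1/4.
  have hF : ∀ x ∈ Θ, ENNReal.ofReal (driftProfile L K (c₂ / ε / 2) (min |x - m| L)) ≤
      ENNReal.ofReal (δ₁ * ε ^ 3 / 6) * (t * (1 / 16)) := by
    intro x _
    have h16 : (1 / 16 : ℝ≥0∞) = ENNReal.ofReal (1 / 16) := by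
      rw [ENNReal.ofReal_div_of_pos (by norm_num)]; norm_num
    rw [h16, ← ENNReal.ofReal_natCast t, ← ENNReal.ofReal_mul (by positivity),
      ← ENNReal.ofReal_mul (by positivity)]
    refine ENNReal.ofReal_le_ofReal ?_
    have hmL := min_le_right |x - m| L
    calc driftProfile L K (c₂ / ε / 2) (min |x - m| L)
        ≤ driftProfile L K (c₂ / ε / 2) L := driftProfile_mono hmL (by linarith)
      _ ≤ 4 * L * Real.exp K * L := driftProfile_le hK.le (by positivity) hL.le (by linarith)
      _ = 4 * Real.exp K * L ^ 2 * c₂ / c₂ := by field_simp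
      _ ≤ 4 * Real.exp K * L ^ 2 * (2 * c₁ * ε) / c₂ := by gcongr
      _ = δ₁ * ε ^ 3 / 6 * (D * X * (1 / 16)) := by
          rw [hD, hX]
          field_simp
          ring
      _ ≤ _ := by gcongr
  have hfinal := worstTV_add_le_of_drift hinv measurableSet_Icc hsupp hdrift hs (t := t)
    (by rintro rfl; simp at ht0) (by simpa using (by positivity : 0 < δ₁ * ε ^ 3 / 6))
    ENNReal.ofReal_ne_top hF
  have hlt : (1 / 8 + 1 / 16 : ℝ≥0∞) < 1 / 4 := by
    rw [← ENNReal.toReal_lt_toReal (by simp) (by simp), ENNReal.toReal_add (by simp) (by simp)]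
    norm_num
  have hmix := mixingTime_le_of_worstTV_lt (hfinal.trans_lt hlt)
  calc ((mixingTime P μ Θ : ℕ∞) : ℝ≥0∞) ≤ (((t + s : ℕ) : ℕ∞) : ℝ≥0∞) := by exact_mod_cast hmix
    _ = ((s : ℕ∞) : ℝ≥0∞) + ENNReal.ofReal t := by
        rw [ENNReal.ofReal_natCast]; push_cast; rw [add_comm]
    _ ≤ _ := by gcongr
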